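/- Conventions. The power graph $\mathcal P(H)$ of a group $H$ is the simple graph with vertex set $H$ in which two distinct elements are adjacent if and only if one of them is an integral power of the other. A cut-set of a finite graph is a set of vertices whose deletion leaves a disconnected graph; a minimum cut-set is a cut-set of least cardinality; the vertex connectivity $\kappa(\Gamma)$ is the least number of vertices whose deletion leaves a graph that is disconnected or has only one vertex. A maximal cyclic subgroup of a group is a cyclic subgroup that is not properly contained in any cyclic subgroup. Theorem. Let $p_1<p_2<p_3$ be primes, let $n_1,n_2,n_3$ be positive integers, let $G$ be a finite non-cyclic abelian group of order $p_1^{n_1}p_2^{n_2}p_3^{n_3}$, and let $P_i$ be the Sylow $p_i$-subgroup of $G$ for $i\in\{1,2,3\}$. Suppose that exactly one of $P_1,P_2,P_3$ is non-cyclic. Then the following hold. (i) Suppose that $p_1=2$ and $P_1$ is non-cyclic, and let $C$ be a maximal cyclic subgroup of $G$ of minimum possible order. Then $$\kappa(\mathcal P(G))=\min\{|P_2P_3|,\ \kappa(\mathcal P(C))\}.$$ More precisely, $|C|=2^{c}p_2^{n_2}p_3^{n_3}$ for some positive integer $c$, and $\kappa(\mathcal P(G))=|P_2P_3|$ if $c>1$,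 while $\kappa(\mathcal P(G))=\kappa(\mathcal P(C))$ if $c=1$. (ii) If $p_1=2$ and $P_k$ is non-cyclic, where $\{j,k\}=\{2,3\}$, then $P_1P_j$ is the only minimum cut-set of $\mathcal P(G)$, and so $\kappa(\mathcal P(G))=|P_1P_j|=p_1^{n_1}p_j^{n_j}$. (iii) If $p_1\ge 3$ and $P_k$ is non-cyclic, where $\{i,j,k\}=\{1,2,3\}$, then $P_iP_j$ is the only minimum cut-set of $\mathcal P(G)$, and so $\kappa(\mathcal P(G))=|P_iP_j|=p_i^{n_i}p_j^{n_j}$. -/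

import Mathlib

open scoped Pointwise

/-- The power graph of a group `G`: the vertices are the elements of `G`, and two distinct vertices
are adjacent iff one of them is an integral power of the other. -/
def powerGraph (G : Type*) [Group G] : SimpleGraph G where
  Adj x y := x ≠ y ∧ ((∃ m : ℤ, y ^ m = x) ∨ ∃ m : ℤ, x ^ m = y)
  symm := ⟨fun _ _ h => ⟨h.1.symm, h.2.symm⟩⟩
  loopless := ⟨fun _ h => h.1 rfl⟩

/-- A set `X` of vertices is a cut-set of `Γ` if deleting it leaves a disconnected graph, i.e. two
remaining vertices are not joined by a walk. (With `Preconnected` the empty graph does not count as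
disconnected, so at least two vertices remain.) -/
def IsCutSet {V : Type*} (Γ : SimpleGraph V) (X : Set V) : Prop :=
  ¬ (Γ.induce Xᶜ).Preconnected

/-- A minimum cut-set: a cut-set of least possible cardinality. -/
def IsMinimumCutSet {V : Type*} (Γ : SimpleGraph V) (X : Set V) : Prop :=
  IsCutSet Γ X ∧ ∀ Y : Set V, IsCutSet Γ Y → X.encard ≤ Y.encard

/-- The vertex connectivity of a (finite) graph: the least number of vertices whose deletion leaves
a graph which is disconnected or has only one vertex. -/
noncomputable def vertexConnectivity {V : Type*} (Γ : SimpleGraph V) : ℕ :=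
  sInf {k : ℕ | ∃ X : Set V, X.encard = k ∧ (IsCutSet Γ X ∨ Xᶜ.encard = 1)}

/-- A maximal cyclic subgroup: a cyclic subgroup not properly contained in a cyclic subgroup. -/
def IsMaximalCyclic {G : Type*} [Group G] (C : Subgroup G) : Prop :=
  Maximal (fun H : Subgroup G => IsCyclic H) C

/-- A maximal cyclic subgroup whose order is least among all maximal cyclic subgroups. -/
def IsMinOrderMaximalCyclic {G : Type*} [Group G] (C : Subgroup G) : Prop :=
  IsMaximalCyclic C ∧ ∀ D : Subgroup G, IsMaximalCyclic D → Nat.card C ≤ Nat.card D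

/-! ### Cut-sets and vertex connectivity of finite graphs -/

/-! Let `p` be the prime whose Sylow subgroup is non-cyclic, and `K` the Hall `p'`-subgroup: it is
cyclic, of order `m`, and lies in every maximal cyclic subgroup `D`, so that `|D| = p ^ c * m` with
`c > 0`.

`K` is a cut-set: a vertex outside `K` generates a group with exactly one subgroup of order `p`,
this subgroup is constant along edges outside `K`, and a non-cyclic abelian `p`-group has at least
two of them (`isCutSet_of_orderOf_eq_prime`). Conversely, a cut-set `X` missing some `z` in `K`
separates `z` from some `v`; a maximal cyclic `D` through `v` also contains `z`, so `X` cuts the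
power graph of `D` (`exists_isMaximalCyclic_isCutSet_preimage`). The problem becomes a comparison of
`m` with cut-sets of cyclic groups of order `p ^ c * m`.

Such a cut-set contains the identity and all generators, hence has more than `φ(p ^ c) φ(m)`
elements. If `m` is odd, `m ≤ 2 φ(m)`, which suffices unless `p ^ c = 2`. If `m` is even, `m ≤ 4
φ(m)`, which suffices unless `p ^ c = 3`; that case needs a finer count
(`lt_ncard_of_card_eq_three_mul`). When `p ^ c = 2`, a maximal cyclic `C` of order `2 * m` has an
explicit cut-set of size at most `m` and below `2 φ(m)`, and cut-sets that small remain cut-sets in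
`G` (`IsMaximalCyclic.isCutSet_image`). -/

theorem isCutSet_iff_exists_separation {V : Type*} (Γ : SimpleGraph V) (X : Set V) :
    IsCutSet Γ X ↔ ∃ Q : V → Prop, (∃ u ∉ X, Q u) ∧ (∃ v ∉ X, ¬ Q v) ∧
      ∀ x ∉ X, ∀ y ∉ X, Γ.Adj x y → (Q x ↔ Q y) := by
  constructor
  · intro h
    simp only [IsCutSet, SimpleGraph.Preconnected, not_forall] at h
    obtain ⟨⟨u, hu⟩, ⟨v, hv⟩, huv⟩ := h
    refine ⟨fun w => ∃ hw : w ∈ Xᶜ, (Γ.induce Xᶜ).Reachable ⟨u, hu⟩ ⟨w, hw⟩,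
      ⟨u, hu, hu, SimpleGraph.Reachable.refl _⟩, ⟨v, hv, fun ⟨_, h⟩ => huv h⟩, ?_⟩
    intro x hx y hy hxy
    have hadj : (Γ.induce Xᶜ).Adj ⟨x, hx⟩ ⟨y, hy⟩ := hxy
    exact ⟨fun ⟨_, h⟩ => ⟨hy, h.trans hadj.reachable⟩,
      fun ⟨_, h⟩ => ⟨hx, h.trans hadj.symm.reachable⟩⟩
  · rintro ⟨Q, ⟨u, hu, hQu⟩, ⟨v, hv, hQv⟩, hQ⟩ hpre
    obtain ⟨w⟩ := hpre ⟨u, hu⟩ ⟨v, hv⟩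
    have key : ∀ a b : ↥(Xᶜ), (Γ.induce Xᶜ).Walk a b → Q a → Q b := by
      intro a b w
      induction w with
      | nil => exact id
      | @cons a b _ h _ ih => exact fun ha => ih ((hQ a a.2 b b.2 h).1 ha)
    exact hQv (key _ _ w hQu)

theorem exists_ncard_eq_vertexConnectivity {V : Type*} [Finite V] [Nonempty V]
    (Γ : SimpleGraph V) :
    ∃ X : Set V, X.ncard = vertexConnectivity Γ ∧ (IsCutSet Γ X ∨ Xᶜ.ncard = 1) := by
  have hne : {k : ℕ | ∃ X : Set V, X.encard = k ∧ (IsCutSet Γ X ∨ Xᶜ.encard = 1)}.Nonempty := by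
    obtain ⟨v⟩ := ‹Nonempty V›
    exact ⟨_, {v}ᶜ, (Set.Finite.cast_ncard_eq (Set.toFinite _)).symm, Or.inr (by simp)⟩
  obtain ⟨X, hX, h⟩ := Nat.sInf_mem hne
  refine ⟨X, ?_, h.imp_right fun h1 => ?_⟩
  · simp [Set.ncard, hX, vertexConnectivity]
  · simp [Set.ncard, h1]

theorem vertexConnectivity_le_of_isCutSet {V : Type*} [Finite V] {Γ : SimpleGraph V} {X : Set V}
    (hX : IsCutSet Γ X) : vertexConnectivity Γ ≤ X.ncard :=
  Nat.sInf_le ⟨X, (Set.Finite.cast_ncard_eq (Set.toFinite _)).symm, Or.inl hX⟩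

theorem le_vertexConnectivity {V : Type*} [Finite V] [Nonempty V] {Γ : SimpleGraph V} {k : ℕ}
    (hk : k + 1 ≤ Nat.card V) (h : ∀ X, IsCutSet Γ X → k ≤ X.ncard) :
    k ≤ vertexConnectivity Γ := by
  obtain ⟨X, hX, hX' | hX'⟩ := exists_ncard_eq_vertexConnectivity Γ
  · exact hX ▸ h X hX'
  · have := Set.ncard_add_ncard_compl X
    omega

theorem isMinimumCutSet_iff_of_forall_lt {V : Type*} [Finite V] {Γ : SimpleGraph V} {K : Set V}
    (hK : IsCutSet Γ K) (h : ∀ X, IsCutSet Γ X → ¬ K ⊆ X → K.ncard < X.ncard) (X : Set V) :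
    IsMinimumCutSet Γ X ↔ X = K := by
  have hle : ∀ Y, IsCutSet Γ Y → K.ncard ≤ Y.ncard := fun Y hY => by
    by_cases hKY : K ⊆ Y
    · exact Set.ncard_le_ncard hKY (Set.toFinite _)
    · exact (h Y hY hKY).le
  have enc : ∀ Y Z : Set V, Y.encard ≤ Z.encard ↔ Y.ncard ≤ Z.ncard := fun Y Z => by
    rw [← Set.Finite.cast_ncard_eq (Set.toFinite Y), ← Set.Finite.cast_ncard_eq (Set.toFinite Z)]
    exact Nat.cast_le
  constructor
  · rintro ⟨hX, hmin⟩
    have hXK := (enc _ _).1 (hmin K hK)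
    by_cases hKX : K ⊆ X
    · exact (Set.eq_of_subset_of_ncard_le hKX hXK (Set.toFinite _)).symm
    · exact absurd (h X hX hKX) (by omega)
  · rintro rfl
    exact ⟨hK, fun Y hY => (enc _ _).2 (hle Y hY)⟩

/-! ### Cut-sets of power graphs -/

theorem powerGraph_adj_iff {G : Type*} [Group G] {x y : G} :
    (powerGraph G).Adj x y ↔
      x ≠ y ∧ (x ∈ Subgroup.zpowers y ∨ y ∈ Subgroup.zpowers x) := Iff.rfl

theorem isCutSet_powerGraph_iff {G : Type*} [Group G] (X : Set G) :
    IsCutSet (powerGraph G) X ↔ ∃ Q : G → Prop, (∃ u ∉ X, Q u) ∧ (∃ v ∉ X, ¬ Q v) ∧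
      ∀ x ∉ X, ∀ y ∉ X, x ∈ Subgroup.zpowers y → (Q x ↔ Q y) := by
  rw [isCutSet_iff_exists_separation]
  refine exists_congr fun Q => and_congr_right fun _ => and_congr_right fun _ => ⟨?_, ?_⟩
  · intro h x hx y hy hxy
    by_cases he : x = y
    · rw [he]
    · exact h x hx y hy (powerGraph_adj_iff.2 ⟨he, Or.inl hxy⟩)
  · intro h x hx y hy hxy
    rcases (powerGraph_adj_iff.1 hxy).2 with h1 | h1
    · exact h x hx y hy h1
    · exact (h y hy x hx h1).symm

/-- A cut-set separates any given remaining vertex from some other remaining vertex. -/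
theorem IsCutSet.exists_separation_of_notMem {G : Type*} [Group G] {X : Set G}
    (hX : IsCutSet (powerGraph G) X) {z : G} :
    ∃ Q : G → Prop, Q z ∧ (∃ v ∉ X, ¬ Q v) ∧
      ∀ x ∉ X, ∀ y ∉ X, x ∈ Subgroup.zpowers y → (Q x ↔ Q y) := by
  obtain ⟨Q, ⟨u, hu, hQu⟩, hv, hQ⟩ := (isCutSet_powerGraph_iff X).1 hX
  by_cases hQz : Q z
  · exact ⟨Q, hQz, hv, hQ⟩
  · exact ⟨fun w => ¬ Q w, hQz, ⟨u, hu, not_not.2 hQu⟩,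
      fun x hx y hy hxy => not_congr (hQ x hx y hy hxy)⟩

/-- A vertex joined to all others would keep the remaining graph connected. In cyclic groups this
applies to the identity and to every generator. -/
theorem mem_of_isCutSet_of_forall_comparable {G : Type*} [Group G] {X : Set G}
    (hX : IsCutSet (powerGraph G) X) {g : G}
    (hg : ∀ x, x ∈ Subgroup.zpowers g ∨ g ∈ Subgroup.zpowers x) : g ∈ X := by
  by_contra hgX
  obtain ⟨Q, hQg, ⟨v, hv, hQv⟩, hQ⟩ := hX.exists_separation_of_notMem (z := g)
  rcases hg v with h | h
  · exact hQv ((hQ v hv g hgX h).2 hQg)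
  · exact hQv ((hQ g hgX v hv h).1 hQg)

theorem IsCutSet.image_mulEquiv {G H : Type*} [Group G] [Group H] {X : Set G}
    (hX : IsCutSet (powerGraph G) X) (e : G ≃* H) : IsCutSet (powerGraph H) (e '' X) := by
  obtain ⟨Q, ⟨u, hu, hQu⟩, ⟨v, hv, hQv⟩, hQ⟩ := (isCutSet_powerGraph_iff X).1 hX
  have hmem : ∀ x, x ∉ e '' X → e.symm x ∉ X := fun x hx h => hx ⟨_, h, by simp⟩
  refine (isCutSet_powerGraph_iff _).2 ⟨fun h => Q (e.symm h), ⟨e u, ?_, by simpa⟩,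
    ⟨e v, ?_, by simpa⟩, fun x hx y hy hxy => hQ _ (hmem x hx) _ (hmem y hy) ?_⟩
  · simpa using hu
  · simpa using hv
  · obtain ⟨k, rfl⟩ := hxy
    exact ⟨k, by simp⟩

theorem mem_zpowers_subtype_iff {G : Type*} [Group G] {D : Subgroup G} {x y : D} :
    x ∈ Subgroup.zpowers y ↔ (x : G) ∈ Subgroup.zpowers (y : G) := by
  simp only [Subgroup.mem_zpowers_iff, Subtype.ext_iff, Subgroup.coe_zpow]

/-! ### Finite cyclic groups -/

theorem IsCyclic.mem_zpowers_iff_orderOf_dvd {H : Type*} [Group H] [Finite H] [IsCyclic H]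
    {x y : H} : x ∈ Subgroup.zpowers y ↔ orderOf x ∣ orderOf y := by
  classical
  have := Fintype.ofFinite H
  refine ⟨orderOf_dvd_of_mem_zpowers, fun h => ?_⟩
  have hsub : (Subgroup.zpowers y : Set H).toFinset ⊆
      Finset.univ.filter fun a : H => a ^ orderOf y = 1 := by
    intro a ha
    simp only [Set.mem_toFinset, SetLike.mem_coe] at ha
    simpa using orderOf_dvd_iff_pow_eq_one.1 (orderOf_dvd_of_mem_zpowers ha)
  have heq := Finset.eq_of_subset_of_card_le hsub (by
    refine (IsCyclic.card_pow_eq_one_le (orderOf_pos y)).trans ?_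
    rw [Set.toFinset_card, ← Nat.card_eq_fintype_card]
    exact (Nat.card_zpowers y).ge)
  have hx : x ∈ (Subgroup.zpowers y : Set H).toFinset := by
    rw [heq]
    simpa using orderOf_dvd_iff_pow_eq_one.1 h
  simpa using hx

theorem IsCyclic.ncard_pow_eq_one {H : Type*} [CommGroup H] [Finite H] [IsCyclic H] {d : ℕ}
    (hd : d ∣ Nat.card H) : {x : H | x ^ d = 1}.ncard = d := by
  have h := IsCyclic.card_powMonoidHom_ker H d
  rw [Nat.gcd_eq_right hd] at h
  rw [← Nat.card_coe_set_eq]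
  exact h

theorem IsCyclic.ncard_orderOf_eq {H : Type*} [Group H] [Finite H] [IsCyclic H] {d : ℕ}
    (hd : d ∣ Nat.card H) : {x : H | orderOf x = d}.ncard = d.totient := by
  classical
  have := Fintype.ofFinite H
  rw [← IsCyclic.card_orderOf_eq_totient (α := H) (by rwa [← Nat.card_eq_fintype_card]),
    ← Set.ncard_coe_finset]
  simp

theorem IsCyclic.setOf_orderOf_eq_card_subset {H : Type*} [Group H] [Finite H] [IsCyclic H]
    {X : Set H} (hX : IsCutSet (powerGraph H) X) : {x : H | orderOf x = Nat.card H} ⊆ X :=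
  fun g hg => mem_of_isCutSet_of_forall_comparable hX fun x =>
    Or.inl (IsCyclic.mem_zpowers_iff_orderOf_dvd.2
      ((show orderOf g = Nat.card H from hg) ▸ orderOf_dvd_natCard x))

theorem one_mem_of_isCutSet {H : Type*} [Group H] {X : Set H}
    (hX : IsCutSet (powerGraph H) X) : (1 : H) ∈ X :=
  mem_of_isCutSet_of_forall_comparable hX fun _ => Or.inr (one_mem _)

theorem IsCyclic.totient_card_lt_ncard {H : Type*} [Group H] [Finite H] [IsCyclic H]
    (h1 : 1 < Nat.card H) {X : Set H} (hX : IsCutSet (powerGraph H) X) :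
    (Nat.card H).totient < X.ncard := by
  rw [← IsCyclic.ncard_orderOf_eq (H := H) dvd_rfl]
  refine Set.ncard_lt_ncard ((IsCyclic.setOf_orderOf_eq_card_subset hX).ssubset_of_ne ?_)
    (Set.toFinite _)
  rintro h
  have := one_mem_of_isCutSet hX
  rw [← h] at this
  simp only [Set.mem_ofPred_eq, orderOf_one] at this
  omega

theorem IsCyclic.totient_card_le_vertexConnectivity {H : Type*} [Group H] [Finite H] [IsCyclic H]
    (h1 : 1 < Nat.card H) : (Nat.card H).totient ≤ vertexConnectivity (powerGraph H) :=
  le_vertexConnectivity (Nat.totient_lt _ h1) fun _ hX =>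
    (IsCyclic.totient_card_lt_ncard h1 hX).le

/-- If one side of a cut of a cyclic group of order `6 * t` consists of elements whose order is
divisible by the full `2`-part and the full `3`-part of the group order, and the orders of such
elements form a chain, then the cut-set has more than `2 * t` elements. -/
theorem two_mul_lt_ncard_of_separation {H : Type*} [CommGroup H] [Finite H] [IsCyclic H] {t : ℕ}
    (hcard : Nat.card H = 6 * t) {X : Set H} (Q : H → Prop) (hne : ∃ v ∉ X, Q v)
    (hQ : ∀ x ∉ X, ∀ y ∉ X, x ∈ Subgroup.zpowers y → (Q x ↔ Q y))
    (hQF : ∀ x ∉ X, Q x → x ^ (3 * t) ≠ 1 ∧ x ^ (2 * t) ≠ 1)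
    (hchain : ∀ x y : H, x ^ (3 * t) ≠ 1 → x ^ (2 * t) ≠ 1 → y ^ (3 * t) ≠ 1 → y ^ (2 * t) ≠ 1 →
      orderOf x ∣ orderOf y ∨ orderOf y ∣ orderOf x) : 2 * t < X.ncard := by
  have hpow : ∀ x : H, x ^ (6 * t) = 1 := fun x => hcard ▸ pow_card_eq_one'
  set F : Set H := {x | x ^ (3 * t) ≠ 1 ∧ x ^ (2 * t) ≠ 1} with hF
  -- Inclusion-exclusion in the cyclic group: `6t - (3t + 2t - t) = 2t`.
  have hFcard : 2 * t ≤ F.ncard := by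
    have hc : Fᶜ = {x | x ^ (3 * t) = 1} ∪ {x | x ^ (2 * t) = 1} := by
      ext x
      simp only [hF, Set.mem_compl_iff, Set.mem_ofPred_eq, Set.mem_union]
      tauto
    have hi : ({x : H | x ^ t = 1} : Set H) ⊆ {x | x ^ (3 * t) = 1} ∩ {x | x ^ (2 * t) = 1} := by
      intro x hx
      have hx : x ^ t = 1 := hx
      constructor <;> simp [mul_comm _ t, pow_mul, hx]
    have h1 := Set.ncard_le_ncard hi (Set.toFinite _)
    have h2 := Set.ncard_union_add_ncard_inter {x : H | x ^ (3 * t) = 1} {x | x ^ (2 * t) = 1}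
    have h3 := Set.ncard_add_ncard_compl F
    rw [IsCyclic.ncard_pow_eq_one (hcard ▸ Dvd.intro_left 6 rfl)] at h1
    rw [IsCyclic.ncard_pow_eq_one (hcard ▸ ⟨2, by ring⟩),
      IsCyclic.ncard_pow_eq_one (hcard ▸ ⟨3, by ring⟩)] at h2
    rw [hc, hcard] at h3
    omega
  -- With `b` of maximal order on the `Q`-side and `Z` the group it generates, the symmetric
  -- difference of `F` and `Z` lies in `X`. It then suffices that `F` fills less than half of `Z`.
  obtain ⟨b, ⟨hbX, hQb⟩, hmax⟩ := Set.exists_max_image {v | v ∉ X ∧ Q v} orderOf (Set.toFinite _) hne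
  have hbF := hQF b hbX hQb
  set Z : Set H := (Subgroup.zpowers b : Set H) with hZ
  have hsub1 : F \ Z ⊆ X := by
    rintro f ⟨hfF, hfZ⟩
    by_contra hfX
    have hfZ : f ∉ Subgroup.zpowers b := hfZ
    rcases hchain f b hfF.1 hfF.2 hbF.1 hbF.2 with h | h
    · exact hfZ (IsCyclic.mem_zpowers_iff_orderOf_dvd.2 h)
    · have hQf : Q f := (hQ b hbX f hfX (IsCyclic.mem_zpowers_iff_orderOf_dvd.2 h)).1 hQb
      have hle := hmax f ⟨hfX, hQf⟩
      have heq := Nat.le_antisymm hle (Nat.le_of_dvd (orderOf_pos f) h)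
      exact hfZ (IsCyclic.mem_zpowers_iff_orderOf_dvd.2 heq.dvd)
  have hsub2 : Z \ F ⊆ X := by
    rintro x ⟨hxZ, hxF⟩
    by_contra hxX
    exact hxF (hQF x hxX ((hQ x hxX b hbX hxZ).2 hQb))
  -- For `x` in `Z ∩ F`, both `x ^ (3 * t)` and `b ^ (3 * t)` are the involution, so multiplying `x`
  -- by `b ^ 3` leaves `F`. The identity is never hit: `x * b ^ 3 = 1` would give `x ^ (2 * t) = 1`.
  have hlt : (Z ∩ F).ncard < (Z \ F).ncard := by
    have hinj : Function.Injective fun x : H => x * b ^ 3 := mul_left_injective _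
    rw [← Set.ncard_image_of_injective (Z ∩ F) hinj]
    have hw : (b ^ (3 * t)) ^ 2 = 1 := by rw [← pow_mul, ← hpow b]; congr 1; ring
    have himg : (fun x : H => x * b ^ 3) '' (Z ∩ F) ⊆ Z \ F := by
      rintro _ ⟨x, ⟨⟨k, rfl⟩, hxF⟩, rfl⟩
      refine ⟨⟨k + 3, by simp [zpow_add]⟩, fun h => h.1 ?_⟩
      have e1 : (b ^ k) ^ (3 * t) = (b ^ (3 * t)) ^ k := by
        rw [← zpow_natCast, ← zpow_natCast, zpow_comm]
      have hk : Odd k := by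
        by_contra hk
        rw [Int.not_odd_iff_even] at hk
        obtain ⟨l, rfl⟩ := hk
        refine hxF.1 ?_
        rw [show (b ^ (l + l)) ^ (3 * t) = (b ^ (3 * t)) ^ (l + l) from e1, ← two_mul, zpow_mul]
        simp only [zpow_ofNat, hw, one_zpow]
      obtain ⟨l, rfl⟩ := hk
      have e2 : (b ^ (2 * l + 1) * b ^ 3) ^ (3 * t) = (b ^ (3 * t)) ^ (2 * (l + 2)) := by
        rw [mul_pow, show (b ^ (2 * l + 1)) ^ (3 * t) = (b ^ (3 * t)) ^ (2 * l + 1) from e1,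
          pow_right_comm, show 2 * (l + 2) = 2 * l + 1 + 3 by ring, zpow_add _ (2 * l + 1) 3,
          zpow_ofNat _ 3]
      show (b ^ (2 * l + 1) * b ^ 3) ^ (3 * t) = 1
      rw [e2, zpow_mul]
      simp only [zpow_ofNat, hw, one_zpow]
    refine Set.ncard_lt_ncard (himg.ssubset_of_ne fun h => ?_) (Set.toFinite _)
    have h1 : (1 : H) ∈ Z \ F := ⟨one_mem (Subgroup.zpowers b), fun h => h.1 (one_pow _)⟩
    rw [← h] at h1
    obtain ⟨x, ⟨-, hxF⟩, hx⟩ := h1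
    have hx : x * b ^ 3 = 1 := hx
    have hb : (b ^ 3) ^ (2 * t) = 1 := by rw [← pow_mul, ← hpow b]; congr 1; ring
    refine hxF.2 ?_
    rw [eq_inv_of_mul_eq_one_left hx, inv_pow, hb, inv_one]
  have h1 : (F \ Z ∪ Z \ F).ncard ≤ X.ncard :=
    Set.ncard_le_ncard (Set.union_subset hsub1 hsub2) (Set.toFinite _)
  rw [Set.ncard_union_eq (Set.disjoint_left.2 fun x hx hx' => hx.2 hx'.1)] at h1
  have h2 := Set.ncard_inter_add_ncard_sdiff_eq_ncard F Z (Set.toFinite _)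
  rw [Set.inter_comm] at h2
  omega

/-- Used contrapositively: a cut-set that is too small must leave an element of order `d` undeleted.
-/
theorem IsCyclic.totient_add_totient_le_ncard {H : Type*} [Group H] [Finite H] [IsCyclic H]
    {X : Set H} (hX : IsCutSet (powerGraph H) X) {d : ℕ} (hd : d ∣ Nat.card H)
    (hd' : d ≠ Nat.card H) (h : {x : H | orderOf x = d} ⊆ X) :
    (Nat.card H).totient + d.totient ≤ X.ncard := by
  have hdisj : Disjoint {x : H | orderOf x = Nat.card H} {x : H | orderOf x = d} :=
    Set.disjoint_left.2 fun x hx hx' => hd' (Eq.trans (Eq.symm hx') hx)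
  rw [← IsCyclic.ncard_orderOf_eq (H := H) dvd_rfl, ← IsCyclic.ncard_orderOf_eq (H := H) hd,
    ← Set.ncard_union_eq hdisj]
  exact Set.ncard_le_ncard (Set.union_subset (IsCyclic.setOf_orderOf_eq_card_subset hX) h)
    (Set.toFinite _)

/-- The two non-vanishing powers force order `3 * 2 ^ (a + 1) * r ^ j`, so only the exponent `j`
varies. -/
theorem orderOf_dvd_or_dvd_of_pow_ne_one {H : Type*} [Group H] [Finite H] {r a b : ℕ}
    (hr : r.Prime) (hcard : Nat.card H = 6 * (2 ^ a * r ^ b)) {x y : H}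
    (hx2 : x ^ (3 * (2 ^ a * r ^ b)) ≠ 1) (hx3 : x ^ (2 * (2 ^ a * r ^ b)) ≠ 1)
    (hy2 : y ^ (3 * (2 ^ a * r ^ b)) ≠ 1) (hy3 : y ^ (2 * (2 ^ a * r ^ b)) ≠ 1) :
    orderOf x ∣ orderOf y ∨ orderOf y ∣ orderOf x := by
  have key : ∀ x : H, x ^ (3 * (2 ^ a * r ^ b)) ≠ 1 → x ^ (2 * (2 ^ a * r ^ b)) ≠ 1 →
      ∃ j, orderOf x = 3 * 2 ^ (a + 1) * r ^ j := by
    intro x h2 h3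
    have hdvd : orderOf x ∣ 3 * (2 ^ (a + 1) * r ^ b) := by
      have := orderOf_dvd_natCard x
      rw [hcard] at this
      convert this using 1
      ring
    obtain ⟨u, v, hu, hv, huv⟩ := exists_dvd_and_dvd_of_dvd_mul hdvd
    obtain ⟨w, z, hw, hz, rfl⟩ := exists_dvd_and_dvd_of_dvd_mul hv
    obtain ⟨i, hi, rfl⟩ := (Nat.dvd_prime_pow Nat.prime_two).1 hw
    obtain ⟨j, hj, rfl⟩ := (Nat.dvd_prime_pow hr).1 hz
    refine ⟨j, ?_⟩
    rcases (Nat.dvd_prime Nat.prime_three).1 hu with rfl | rfl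
    · refine absurd (orderOf_dvd_iff_pow_eq_one.1 ?_) h3
      rw [huv, one_mul, ← mul_assoc, ← pow_succ']
      exact Nat.mul_dvd_mul hw hz
    · rcases Nat.lt_or_ge i (a + 1) with h | h
      · refine absurd (orderOf_dvd_iff_pow_eq_one.1 ?_) h2
        rw [huv]
        exact Nat.mul_dvd_mul dvd_rfl (Nat.mul_dvd_mul (pow_dvd_pow _ (by omega)) hz)
      · rw [huv, le_antisymm hi h, mul_assoc]
  obtain ⟨i, hi⟩ := key x hx2 hx3
  obtain ⟨j, hj⟩ := key y hy2 hy3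
  rw [hi, hj]
  rcases le_total i j with h | h
  · exact Or.inl (Nat.mul_dvd_mul dvd_rfl (pow_dvd_pow _ h))
  · exact Or.inr (Nat.mul_dvd_mul dvd_rfl (pow_dvd_pow _ h))

/-- Write the order as `6 * t`. A cut-set of at most `2 * t` elements leaves some `g` of order `2 *
t` and some `k` of order `3 * t`. If these lie on the same side, the other side avoids both
subgroups they generate, and the chain argument applies. Otherwise the common subgroup of order `t`
is deleted together with all generators, which is too many elements. -/
theorem lt_ncard_of_card_eq_three_mul {H : Type*} [CommGroup H] [Finite H] [IsCyclic H] {r a b : ℕ}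
    (hr : r.Prime) (hr5 : 5 ≤ r) (ha : 0 < a) (hb : 0 < b)
    (hcard : Nat.card H = 3 * (2 ^ a * r ^ b)) {X : Set H} (hX : IsCutSet (powerGraph H) X) :
    2 ^ a * r ^ b < X.ncard := by
  obtain ⟨a, rfl⟩ := Nat.exists_eq_add_one.2 ha
  obtain ⟨b, rfl⟩ := Nat.exists_eq_add_one.2 hb
  set t := 2 ^ a * r ^ (b + 1) with ht
  have hcard' : Nat.card H = 6 * t := by rw [hcard, ht]; ring
  rw [show 2 ^ (a + 1) * r ^ (b + 1) = 2 * t by rw [ht]; ring]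
  have h2r : Nat.Coprime 2 r := (Nat.coprime_primes Nat.prime_two hr).2 (by omega)
  have h3r : Nat.Coprime 3 r := (Nat.coprime_primes Nat.prime_three hr).2 (by omega)
  obtain ⟨s, rfl⟩ : ∃ s, r = s + 1 := ⟨r - 1, by omega⟩
  set N := 2 ^ a * (s + 1) ^ b with hN
  have htN : t = N * (s + 1) := by rw [ht, hN]; ring
  have hNpos : 0 < N := by positivity
  have hφr : ((s + 1) ^ (b + 1)).totient = (s + 1) ^ b * s := by
    rw [Nat.totient_prime_pow_succ hr]; simp
  have hφ3 : Nat.totient 3 = 2 := by decide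
  have hφt : ∀ u, (2 ^ u * (s + 1) ^ (b + 1)).totient = (2 ^ u).totient * ((s + 1) ^ b * s) :=
    fun u => by
      rw [Nat.totient_mul (Nat.Coprime.pow _ _ h2r), hφr]
  have hφ3t : ∀ u, (3 * (2 ^ u * (s + 1) ^ (b + 1))).totient =
      2 * ((2 ^ u).totient * ((s + 1) ^ b * s)) := fun u => by
    rw [Nat.totient_mul (Nat.Coprime.mul_right (Nat.Coprime.pow_right _ (by decide))
      (Nat.Coprime.pow_right _ h3r)), hφ3, hφt]
  have hφ2 : (2 ^ (a + 1)).totient = 2 ^ a := by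
    rw [Nat.totient_prime_pow_succ Nat.prime_two]; simp
  have hφ2' : 2 ^ a ≤ 2 * (2 ^ a).totient := by
    rcases a with _ | a
    · simp
    · rw [Nat.totient_prime_pow_succ Nat.prime_two, pow_succ']; simp
  have hgen : (Nat.card H).totient = 2 * (N * s) := by
    rw [hcard, hφ3t, hφ2, hN]; ring
  by_contra hle
  -- This is where `r ≥ 5` enters: with `2 * t = 2 * N * s + 2 * N`, it makes `3 * N * s` exceed `2
  -- * t`.
  have hs : 4 * N ≤ N * s := by rw [mul_comm]; exact Nat.mul_le_mul_left _ (by omega)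
  have ht' : t = N * s + N := by rw [htN]; ring
  obtain ⟨g, hg, hgX⟩ : ∃ g : H, orderOf g = 2 * t ∧ g ∉ X := by
    by_contra! h
    have h1 := IsCyclic.totient_add_totient_le_ncard hX (d := 2 * t) (hcard' ▸ ⟨3, by ring⟩)
      (by omega) h
    have h2 : (2 * t).totient = N * s := by
      rw [show 2 * t = 2 ^ (a + 1) * (s + 1) ^ (b + 1) by rw [ht]; ring, hφt, hφ2, hN]; ring
    omega
  obtain ⟨k, hk, hkX⟩ : ∃ k : H, orderOf k = 3 * t ∧ k ∉ X := by
    by_contra! h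
    have h1 := IsCyclic.totient_add_totient_le_ncard hX (d := 3 * t) (hcard' ▸ ⟨2, by ring⟩)
      (by omega) h
    have h2 : N * s ≤ (3 * t).totient := by
      rw [hφ3t, hN, ← mul_assoc, mul_assoc (2 ^ a)]
      exact Nat.mul_le_mul_right _ hφ2'
    omega
  obtain ⟨Q, hQg, ⟨v, hvX, hQv⟩, hQ⟩ := hX.exists_separation_of_notMem (z := g)
  have hbelow : ∀ (x y : H), x ∉ X → y ∉ X → x ^ orderOf y = 1 → (Q x ↔ Q y) :=
    fun x y hx hy h => hQ x hx y hy
      (IsCyclic.mem_zpowers_iff_orderOf_dvd.2 (orderOf_dvd_of_pow_eq_one h))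
  by_cases hQk : Q k
  · refine hle (two_mul_lt_ncard_of_separation hcard' (fun x => ¬ Q x) ⟨v, hvX, hQv⟩
      (fun x hx y hy h => not_congr (hQ x hx y hy h)) (fun x hx hQx => ⟨fun h => hQx ?_,
      fun h => hQx ?_⟩) fun x y h1 h2 h3 h4 => orderOf_dvd_or_dvd_of_pow_ne_one hr hcard' h1 h2 h3 h4)
    · exact (hbelow x k hx hkX (hk ▸ h)).2 hQk
    · exact (hbelow x g hx hgX (hg ▸ h)).2 hQg
  · have hsub : {x : H | x ^ t = 1} ⊆ X := by
      intro x hx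
      have hx : x ^ t = 1 := hx
      by_contra hxX
      refine hQk ((hbelow x k hxX hkX ?_).1 ((hbelow x g hxX hgX ?_).2 hQg))
      · rw [hk, mul_comm, pow_mul, hx, one_pow]
      · rw [hg, mul_comm, pow_mul, hx, one_pow]
    have hdisj : Disjoint {x : H | orderOf x = Nat.card H} {x : H | x ^ t = 1} := by
      refine Set.disjoint_left.2 fun x hx hx' => ?_
      have h1 := Nat.le_of_dvd (by omega) (orderOf_dvd_of_pow_eq_one (show x ^ t = 1 from hx'))
      have h2 : orderOf x = Nat.card H := hx
      omega
    have h1 := Set.ncard_le_ncard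
      (Set.union_subset (IsCyclic.setOf_orderOf_eq_card_subset hX) hsub) (Set.toFinite _)
    rw [Set.ncard_union_eq hdisj, IsCyclic.ncard_orderOf_eq dvd_rfl, hgen,
      IsCyclic.ncard_pow_eq_one (hcard' ▸ Dvd.intro_left 6 rfl)] at h1
    omega

/-- A small cut-set in a cyclic group of order `2 * m`, where `m` is odd with exactly two prime
divisors. -/
theorem exists_isCutSet_of_card_eq_two_mul {H : Type*} [CommGroup H] [Finite H] [IsCyclic H]
    {q r a b : ℕ} (hq : q.Prime) (hr : r.Prime) (hq3 : 3 ≤ q) (hqr : q < r) (ha : 0 < a)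
    (hb : 0 < b) (hcard : Nat.card H = 2 * (q ^ a * r ^ b)) :
    ∃ X : Set H, IsCutSet (powerGraph H) X ∧ X.ncard ≤ q ^ a * r ^ b ∧
      X.ncard < 2 * (q ^ a * r ^ b).totient := by
  obtain ⟨a, rfl⟩ := Nat.exists_eq_add_one.2 ha
  obtain ⟨b, rfl⟩ := Nat.exists_eq_add_one.2 hb
  set N := q ^ a * r ^ b with hN
  have hNpos : 0 < N := Nat.mul_pos (pow_pos hq.pos _) (pow_pos hr.pos _)
  have hm : q ^ (a + 1) * r ^ (b + 1) = N * q * r := by rw [hN]; ring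
  have hcopr : Nat.Coprime q r := (Nat.coprime_primes hq hr).2 hqr.ne
  have hodd : ∀ {s : ℕ}, s.Prime → 3 ≤ s → Nat.Coprime 2 s := fun hs h3 =>
    (Nat.coprime_primes Nat.prime_two hs).2 (by omega)
  have hφ : (q ^ (a + 1) * r ^ (b + 1)).totient = N * ((q - 1) * (r - 1)) := by
    rw [Nat.totient_mul (Nat.Coprime.pow _ _ hcopr), Nat.totient_prime_pow_succ hq,
      Nat.totient_prime_pow_succ hr, hN]
    ring
  have h2m : Nat.Coprime 2 (q ^ (a + 1) * r ^ (b + 1)) :=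
    Nat.Coprime.mul_right (Nat.Coprime.pow_right _ (hodd hq hq3))
      (Nat.Coprime.pow_right _ (hodd hr (by omega)))
  have hφ2 : (Nat.card H).totient = N * ((q - 1) * (r - 1)) := by
    rw [hcard, Nat.totient_mul h2m, hφ]; simp
  have hcard' : Nat.card H = 2 * N * q * r := by rw [hcard, hm]; ring
  have hrodd : ¬ r ∣ 2 := fun h => by have := Nat.le_of_dvd (by omega) h; omega
  set S : Set H := {x | orderOf x = Nat.card H} with hS
  set T : Set H := {x | x ^ (N * q) = 1} with hT
  set U : Set H := {x | x ^ (2 * N) = 1} with hU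
  -- Let `M_l` be the subgroup of prime index `l`. The set consists of the generators and `M_r ∩
  -- (M_2 ∪ M_q)`, and it isolates the rest of `M_r`. The intersections `M_r ∩ M_2` and `M_r ∩ M_q`
  -- have orders `N * q` and `2 * N`.
  refine ⟨S ∪ {x | x ^ (2 * N * q) = 1 ∧ (x ^ (N * q * r) = 1 ∨ x ^ (2 * N * r) = 1)}, ?_, ?_⟩
  · have hn0 : 2 * N * q * r ≠ 0 := hcard' ▸ Nat.card_pos.ne'
    have hex : ∀ d, d ∣ Nat.card H → ∃ x : H, orderOf x = d := fun d hd => by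
      obtain ⟨g, hg⟩ := IsCyclic.exists_ofOrder_eq_natCard (α := H)
      obtain ⟨e, he⟩ := hd
      refine ⟨g ^ e, ?_⟩
      have he0 : e ≠ 0 := by rintro rfl; simp at he; omega
      rw [orderOf_pow_of_dvd he0 (by rw [hg, he]; exact Dvd.intro_left d rfl), hg, he]
      exact Nat.mul_div_cancel _ (Nat.pos_of_ne_zero he0)
    obtain ⟨u, hu⟩ := hex (2 * N * q) (hcard' ▸ Dvd.intro r rfl)
    obtain ⟨v, hv⟩ := hex (N * q * r) (hcard' ▸ ⟨2, by ring⟩)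
    have hdiv : ∀ {k s e : ℕ}, s.Prime → k ≠ 0 → ¬ s ∣ e → ¬ k * s ∣ k * e :=
      fun {k s e} _ hk h hd => h ((Nat.mul_dvd_mul_iff_left (Nat.pos_of_ne_zero hk)).1 hd)
    have hvU : v ^ (2 * N * q) ≠ 1 := fun h => by
      have := orderOf_dvd_of_pow_eq_one h
      rw [hv, show 2 * N * q = N * q * 2 by ring] at this
      exact hdiv hr (Nat.mul_pos hNpos hq.pos).ne' hrodd this
    refine (isCutSet_powerGraph_iff _).2 ⟨fun x => x ^ (2 * N * q) = 1, ⟨u, ?_, ?_⟩, ⟨v, ?_, hvU⟩, ?_⟩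
    · rintro (h | ⟨-, h | h⟩)
      · have h : orderOf u = Nat.card H := h
        rw [hu, hcard'] at h
        have : 2 * N * q * 1 < 2 * N * q * r :=
          Nat.mul_lt_mul_of_pos_left (by omega) (by positivity)
        omega
      · have := orderOf_dvd_of_pow_eq_one h
        rw [hu, show 2 * N * q = N * q * 2 by ring] at this
        exact hdiv Nat.prime_two (Nat.mul_pos hNpos hq.pos).ne'
          ((Nat.Prime.coprime_iff_not_dvd Nat.prime_two).1 (hodd hr (by omega))) this
      · have := orderOf_dvd_of_pow_eq_one h
        rw [hu] at this
        exact hdiv hq (by positivity) ((Nat.Prime.coprime_iff_not_dvd hq).1 hcopr) this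
    · show u ^ (2 * N * q) = 1
      rw [← hu, pow_orderOf_eq_one]
    · rintro (h | ⟨h, -⟩)
      · have h : orderOf v = Nat.card H := h
        rw [hv, hcard'] at h
        have : 0 < N * q * r := Nat.mul_pos (Nat.mul_pos hNpos hq.pos) hr.pos
        nlinarith
      · exact hvU h
    · rintro x hx y hy ⟨k, rfl⟩
      have hk : ∀ e : ℕ, y ^ e = 1 → (y ^ k) ^ e = 1 := fun e he => by
        rw [← zpow_natCast, zpow_comm, zpow_natCast, he, one_zpow]
      refine ⟨fun h => ?_, hk _⟩
      by_contra hyr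
      have hyn : orderOf y ≠ Nat.card H := fun h => hy (Or.inl h)
      have hyd := orderOf_dvd_natCard y
      obtain ⟨e, he⟩ := hyd
      have he1 : e ≠ 1 := by rintro rfl; exact hyn (by rw [he, mul_one])
      -- The non-generator `y` lies in the subgroup of index `s` for some prime `s`; as `y` is
      -- outside `M_r`, it is in `M_2` or `M_q`, and so is its power `x`, which would then be
      -- deleted.
      obtain ⟨s, hs, hse⟩ := Nat.exists_prime_and_dvd he1
      obtain ⟨f, rfl⟩ := hse
      have hsn : s ∣ 2 * N * q * r := by rw [← hcard', he]; exact ⟨orderOf y * f, by ring⟩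
      have hys : ∀ d, 2 * N * q * r = s * d → y ^ d = 1 := fun d hd => by
        refine orderOf_dvd_iff_pow_eq_one.1 ⟨f, ?_⟩
        have : s * d = s * (orderOf y * f) := by rw [← hd, ← hcard', he]; ring
        exact Nat.eq_of_mul_eq_mul_left hs.pos this
      have hs3 : s = 2 ∨ s = q ∨ s = r := by
        have h1 : s ∣ 2 * (q ^ (a + 1) * r ^ (b + 1)) := by
          rw [hm]; convert hsn using 1; ring
        rcases (hs.dvd_mul).1 h1 with h1 | h1
        · exact Or.inl ((Nat.prime_dvd_prime_iff_eq hs Nat.prime_two).1 h1)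
        · rcases (hs.dvd_mul).1 h1 with h1 | h1
          · exact Or.inr (Or.inl ((Nat.prime_dvd_prime_iff_eq hs hq).1 (hs.dvd_of_dvd_pow h1)))
          · exact Or.inr (Or.inr ((Nat.prime_dvd_prime_iff_eq hs hr).1 (hs.dvd_of_dvd_pow h1)))
      rcases hs3 with rfl | rfl | rfl
      · exact hx (Or.inr ⟨h, Or.inl (hk _ (hys _ (by ring)))⟩)
      · exact hx (Or.inr ⟨h, Or.inr (hk _ (hys _ (by ring)))⟩)
      · exact hyr (hys _ (by ring))
  · have hle : (S ∪ {x | x ^ (2 * N * q) = 1 ∧ (x ^ (N * q * r) = 1 ∨ x ^ (2 * N * r) = 1)}).ncard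
        ≤ N * ((q - 1) * (r - 1)) + (N * q + 2 * N) := by
      have hsub : (S ∪ {x : H | x ^ (2 * N * q) = 1 ∧ (x ^ (N * q * r) = 1 ∨ x ^ (2 * N * r) = 1)})
          ⊆ S ∪ (T ∪ U) := by
        refine Set.union_subset_union_right _ ?_
        rintro x ⟨h1, h2 | h2⟩
        · refine Or.inl (orderOf_dvd_iff_pow_eq_one.1 ?_)
          have := Nat.dvd_gcd (orderOf_dvd_of_pow_eq_one h1) (orderOf_dvd_of_pow_eq_one h2)
          rwa [show 2 * N * q = N * q * 2 by ring, Nat.gcd_mul_left, (hodd hr (by omega)).gcd_eq_one,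
            mul_one] at this
        · refine Or.inr (orderOf_dvd_iff_pow_eq_one.1 ?_)
          have := Nat.dvd_gcd (orderOf_dvd_of_pow_eq_one h1) (orderOf_dvd_of_pow_eq_one h2)
          rwa [Nat.gcd_mul_left, hcopr.gcd_eq_one, mul_one] at this
      have h1 : S.ncard = N * ((q - 1) * (r - 1)) := by
        rw [← hφ2]; exact IsCyclic.ncard_orderOf_eq dvd_rfl
      have h2 : T.ncard = N * q := IsCyclic.ncard_pow_eq_one (hcard' ▸ ⟨2 * r, by ring⟩)
      have h3 : U.ncard = 2 * N := IsCyclic.ncard_pow_eq_one (hcard' ▸ ⟨q * r, by ring⟩)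
      have h4 := Set.ncard_le_ncard hsub (Set.toFinite _)
      have h5 := Set.ncard_union_le S (T ∪ U)
      have h6 := Set.ncard_union_le T U
      omega
    have hr5 : 5 ≤ r := by
      rcases Nat.lt_or_ge r 5 with h | h
      · have : r = 4 := by omega
        subst this
        exact absurd hr (by decide)
      · exact h
    rw [hφ, hm]
    obtain ⟨q, rfl⟩ : ∃ q', q = q' + 1 := ⟨q - 1, by omega⟩
    obtain ⟨r, rfl⟩ : ∃ r', r = r' + 1 := ⟨r - 1, by omega⟩
    simp only [Nat.add_sub_cancel] at hle ⊢
    have e1 : q * r + q + 3 ≤ (q + 1) * (r + 1) := by nlinarith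
    have e2 : q * r + q + 3 < 2 * (q * r) := by nlinarith
    have e3 := Nat.mul_le_mul_left N e1
    have e4 := Nat.mul_lt_mul_of_pos_left e2 hNpos
    constructor <;> nlinarith

/-! ### Finite abelian groups with a cyclic Hall `p'`-subgroup -/

/-- The kernel of the `m`-th power map contains `K`; by Cauchy its order is prime to `p`, so it
divides `m`. -/
theorem mem_iff_pow_eq_one_of_coprime {G : Type*} [CommGroup G] [Finite G] {p m e : ℕ}
    (hp : p.Prime) (hpm : p.Coprime m) (hcard : Nat.card G = p ^ e * m) {K : Subgroup G}
    (hK : Nat.card K = m) (x : G) : x ∈ K ↔ x ^ m = 1 := by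
  have := Fact.mk hp
  set T := (powMonoidHom m : G →* G).ker with hT
  have hmem : ∀ x, x ∈ T ↔ x ^ m = 1 := fun x => Iff.rfl
  have hKT : K ≤ T := fun x hx => (hmem x).2 (by
    have : (⟨x, hx⟩ : K) ^ m = 1 := hK ▸ pow_card_eq_one'
    simpa [Subtype.ext_iff] using this)
  have hTp : (Nat.card T).Coprime (p ^ e) := by
    refine Nat.Coprime.pow_right _ (Nat.Coprime.symm ((Nat.Prime.coprime_iff_not_dvd hp).2 ?_))
    intro hd
    obtain ⟨t, ht⟩ := exists_prime_orderOf_dvd_card' p hd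
    have h1 : orderOf (t : G) ∣ m := orderOf_dvd_of_pow_eq_one ((hmem _).1 t.2)
    rw [Subgroup.orderOf_coe, ht] at h1
    exact (Nat.Prime.coprime_iff_not_dvd hp).1 hpm h1
  have hTm : Nat.card T ∣ m := hTp.dvd_of_dvd_mul_left (hcard ▸ Subgroup.card_subgroup_dvd_card T)
  have hm : 0 < m := hK ▸ Nat.card_pos
  rw [Subgroup.eq_of_le_of_card_ge hKT (hK ▸ Nat.le_of_dvd hm hTm), hmem]

theorem mem_iff_not_dvd_orderOf {G : Type*} [CommGroup G] [Finite G] {p m e : ℕ}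
    (hp : p.Prime) (hpm : p.Coprime m) (hcard : Nat.card G = p ^ e * m) {K : Subgroup G}
    (hK : Nat.card K = m) (x : G) : x ∈ K ↔ ¬ p ∣ orderOf x := by
  rw [mem_iff_pow_eq_one_of_coprime hp hpm hcard hK, ← orderOf_dvd_iff_pow_eq_one,
    ← Nat.Prime.coprime_iff_not_dvd hp]
  refine ⟨fun h => Nat.Coprime.coprime_dvd_right h hpm, fun h => ?_⟩
  exact (Nat.Coprime.pow_left e h).symm.dvd_of_dvd_mul_left (hcard ▸ orderOf_dvd_natCard x)

theorem mem_zpowers_mul_of_coprime {G : Type*} [CommGroup G] [Finite G] {a b : G}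
    (h : (orderOf a).Coprime (orderOf b)) : a ∈ Subgroup.zpowers (a * b) := by
  have h1 : a ∈ Subgroup.zpowers (a ^ orderOf b) := mem_zpowers_pow_iff.2 h.symm
  have h2 : (a * b) ^ orderOf b = a ^ orderOf b := by rw [mul_pow, pow_orderOf_eq_one, mul_one]
  rw [← h2] at h1
  exact Subgroup.zpowers_le.2 (Subgroup.npow_mem_zpowers _ _) h1

theorem exists_zpowers_ge_of_pow_eq_one {G : Type*} [CommGroup G] [Finite G] {p m e : ℕ}
    (hpm : p.Coprime m) {K : Subgroup G} [IsCyclic K] (hK : Nat.card K = m) {h : G}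
    (hh : h ^ p ^ e = 1) :
    ∃ g, h ∈ Subgroup.zpowers g ∧ K ≤ Subgroup.zpowers g ∧ orderOf g = orderOf h * m := by
  obtain ⟨μ, hμ⟩ := IsCyclic.exists_generator (α := K)
  have hμo : orderOf (μ : G) = m := by
    rw [Subgroup.orderOf_coe, orderOf_eq_card_of_forall_mem_zpowers hμ, hK]
  have hco : (orderOf h).Coprime (orderOf (μ : G)) := by
    rw [hμo]
    exact Nat.Coprime.coprime_dvd_left (orderOf_dvd_of_pow_eq_one hh) (Nat.Coprime.pow_left _ hpm)
  refine ⟨h * μ, mem_zpowers_mul_of_coprime hco, fun x hx => ?_, ?_⟩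
  · have h1 : x ∈ Subgroup.zpowers (μ : G) :=
      mem_zpowers_subtype_iff.1 (hμ ⟨x, hx⟩)
    refine Subgroup.zpowers_le.2 ?_ h1
    rw [mul_comm]
    exact mem_zpowers_mul_of_coprime hco.symm
  · rw [(Commute.all _ _).orderOf_mul_eq_mul_orderOf_of_coprime hco, hμo]

theorem exists_zpowers_ge {G : Type*} [CommGroup G] [Finite G] {p m e : ℕ}
    (hp : p.Prime) (hpm : p.Coprime m) (he : 0 < e) (hcard : Nat.card G = p ^ e * m)
    {K : Subgroup G} [IsCyclic K] (hK : Nat.card K = m) (x : G) :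
    ∃ g, x ∈ Subgroup.zpowers g ∧ K ≤ Subgroup.zpowers g ∧
      ∃ c, 0 < c ∧ orderOf g = p ^ c * m := by
  have := Fact.mk hp
  -- An `x` in `K` has no `p`-part, so an element of order `p` is adjoined to ensure `c > 0`.
  by_cases hx : x ∈ K
  · obtain ⟨h, hh⟩ := exists_prime_orderOf_dvd_card' (G := G) p
      (hcard ▸ (dvd_pow_self p he.ne').mul_right m)
    obtain ⟨g, -, hg2, hg3⟩ := exists_zpowers_ge_of_pow_eq_one (p := p) (e := 1) hpm hK (h := h)
      (by rw [pow_one, ← hh, pow_orderOf_eq_one])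
    exact ⟨g, hg2 hx, hg2, 1, one_pos, by rw [hg3, hh, pow_one]⟩
  · have hpow : (x ^ m) ^ p ^ e = 1 := by
      rw [← pow_mul, mul_comm, ← hcard, pow_card_eq_one']
    obtain ⟨g, hg1, hg2, hg3⟩ := exists_zpowers_ge_of_pow_eq_one hpm hK hpow
    obtain ⟨c, -, hc⟩ := (Nat.dvd_prime_pow hp).1 (orderOf_dvd_of_pow_eq_one hpow)
    refine ⟨g, ?_, hg2, c, Nat.pos_of_ne_zero ?_, by rw [hg3, hc]⟩
    -- Bézout: `x` is recovered from `x ^ m` and `x ^ p ^ e`.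
    · have hxK : x ^ p ^ e ∈ Subgroup.zpowers g := hg2 <| by
        rw [mem_iff_pow_eq_one_of_coprime hp hpm hcard hK, ← pow_mul, ← hcard, pow_card_eq_one']
      have hgcd := Subgroup.zpow_mem _ hg1 (Nat.gcdA m (p ^ e))
      have hgcd' := Subgroup.zpow_mem _ hxK (Nat.gcdB m (p ^ e))
      have := Subgroup.mul_mem _ hgcd hgcd'
      rw [← zpow_natCast, ← zpow_natCast, ← zpow_mul, ← zpow_mul, ← zpow_add,
        ← Nat.gcd_eq_gcd_ab, (Nat.Coprime.pow_left e hpm).symm.gcd_eq_one] at this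
      simpa using this
    · rintro rfl
      rw [pow_zero, orderOf_eq_one_iff] at hc
      exact hx ((mem_iff_pow_eq_one_of_coprime hp hpm hcard hK x).2 hc)

theorem exists_isMaximalCyclic_mem {G : Type*} [Group G] [Finite G] (x : G) :
    ∃ D : Subgroup G, IsMaximalCyclic D ∧ x ∈ D := by
  obtain ⟨D, hD, hmax⟩ := Finite.exists_le_maximal (p := fun H : Subgroup G => IsCyclic H)
    (show IsCyclic (Subgroup.zpowers x) from inferInstance)
  exact ⟨D, hmax, hD (Subgroup.mem_zpowers x)⟩

theorem IsMaximalCyclic.le_and_exists_card_eq {G : Type*} [CommGroup G] [Finite G] {p m e : ℕ}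
    (hp : p.Prime) (hpm : p.Coprime m) (he : 0 < e) (hcard : Nat.card G = p ^ e * m)
    {K : Subgroup G} [IsCyclic K] (hK : Nat.card K = m) {D : Subgroup G}
    (hD : IsMaximalCyclic D) : K ≤ D ∧ ∃ c, 0 < c ∧ Nat.card D = p ^ c * m := by
  obtain ⟨x, rfl⟩ := (Subgroup.isCyclic_iff_exists_zpowers_eq_top D).1 hD.prop
  obtain ⟨g, hxg, hKg, c, hc, hgc⟩ := exists_zpowers_ge hp hpm he hcard hK x
  have heq : Subgroup.zpowers x = Subgroup.zpowers g :=
    hD.eq_of_le (show IsCyclic (Subgroup.zpowers g) from inferInstance)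
      (Subgroup.zpowers_le.2 hxg)
  rw [heq]
  exact ⟨hKg, c, hc, by rw [Nat.card_zpowers, hgc]⟩

theorem isCutSet_of_orderOf_eq_prime {G : Type*} [CommGroup G] [Finite G] {p m e : ℕ}
    (hp : p.Prime) (hpm : p.Coprime m) (hcard : Nat.card G = p ^ e * m) {K : Subgroup G}
    (hK : Nat.card K = m) {a b : G} (ha : orderOf a = p) (hb : orderOf b = p)
    (hab : a ∉ Subgroup.zpowers b) : IsCutSet (powerGraph G) (K : Set G) := by
  have hmem : ∀ x, x ∉ (K : Set G) ↔ p ∣ orderOf x := fun x => by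
    rw [SetLike.mem_coe, mem_iff_not_dvd_orderOf hp hpm hcard hK, not_not]
  refine (isCutSet_powerGraph_iff _).2 ⟨fun x => a ∈ Subgroup.zpowers x,
    ⟨a, (hmem a).2 ha.symm.dvd, Subgroup.mem_zpowers a⟩, ⟨b, (hmem b).2 hb.symm.dvd, hab⟩, ?_⟩
  intro x hx y hy hxy
  refine ⟨fun h => Subgroup.zpowers_le.2 hxy h, fun h => ?_⟩
  have hdvd : orderOf (⟨a, h⟩ : Subgroup.zpowers y) ∣ orderOf (⟨x, hxy⟩ : Subgroup.zpowers y) := by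
    rw [Subgroup.orderOf_mk, Subgroup.orderOf_mk, ha]
    exact (hmem x).1 hx
  exact mem_zpowers_subtype_iff.1 (IsCyclic.mem_zpowers_iff_orderOf_dvd.2 hdvd)

theorem exists_isMaximalCyclic_isCutSet_preimage {G : Type*} [CommGroup G] [Finite G]
    {p m e : ℕ} (hp : p.Prime) (hpm : p.Coprime m) (he : 0 < e) (hcard : Nat.card G = p ^ e * m)
    {K : Subgroup G} [IsCyclic K] (hK : Nat.card K = m) {X : Set G}
    (hX : IsCutSet (powerGraph G) X) (hKX : ¬ (K : Set G) ⊆ X) :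
    ∃ D : Subgroup G, IsMaximalCyclic D ∧
      IsCutSet (powerGraph D) ((Subtype.val : D → G) ⁻¹' X) := by
  obtain ⟨z, hzK, hzX⟩ := Set.not_subset.1 hKX
  obtain ⟨Q, hQz, ⟨v, hvX, hQv⟩, hQ⟩ := hX.exists_separation_of_notMem (z := z)
  obtain ⟨D, hD, hvD⟩ := exists_isMaximalCyclic_mem v
  refine ⟨D, hD, (isCutSet_powerGraph_iff _).2 ⟨fun x => Q x,
    ⟨⟨z, (hD.le_and_exists_card_eq hp hpm he hcard hK).1 hzK⟩, hzX, hQz⟩, ⟨⟨v, hvD⟩, hvX, hQv⟩,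
    fun x hx y hy hxy => hQ x hx y hy (mem_zpowers_subtype_iff.1 hxy)⟩⟩

theorem ncard_preimage_val_le {G : Type*} [Finite G] {s : Set G} (X : Set G) :
    ((Subtype.val : s → G) ⁻¹' X).ncard ≤ X.ncard := by
  rw [← Set.ncard_image_of_injective _ Subtype.val_injective]
  exact Set.ncard_le_ncard (Set.image_preimage_subset _ _) (Set.toFinite _)

/-- A cut-set of a maximal cyclic subgroup `C` of order `p * m`, where `m` is the `p'`-part of
`|G|`, is a cut-set of the whole group as soon as it is not too large. -/
theorem IsMaximalCyclic.isCutSet_image {G : Type*} [CommGroup G] [Finite G] {p m e : ℕ}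
    (hp : p.Prime) (hpm : p.Coprime m) (he : 0 < e) (hcard : Nat.card G = p ^ e * m)
    {K : Subgroup G} [IsCyclic K] (hK : Nat.card K = m) {C : Subgroup G}
    (hC : IsMaximalCyclic C) (hCcard : Nat.card C = p * m) {X : Set C}
    (hX : IsCutSet (powerGraph C) X) (hlt : X.ncard < (p * m).totient + m.totient) :
    IsCutSet (powerGraph G) ((Subtype.val : C → G) '' X) := by
  have hcyc : IsCyclic C := hC.prop
  have hm : 0 < m := hK ▸ Nat.card_pos
  have hKC := (hC.le_and_exists_card_eq hp hpm he hcard hK).1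
  have hmemK := mem_iff_pow_eq_one_of_coprime hp hpm hcard hK
  -- The size bound leaves a generator `z` of `K`, which holds all of `K \ X` on its side. The other
  -- side therefore lies in `C \ K`.
  obtain ⟨z, hz, hzX⟩ : ∃ z : C, orderOf z = m ∧ z ∉ X := by
    by_contra! h
    have h1 := IsCyclic.totient_add_totient_le_ncard hX (d := m) (hCcard ▸ Dvd.intro_left p rfl)
      (by have := hp.two_le; rw [hCcard]; nlinarith) h
    rw [hCcard] at h1
    omega
  obtain ⟨Q, hQz, ⟨v, hvX, hQv⟩, hQ⟩ := hX.exists_separation_of_notMem (z := z)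
  have hQK : ∀ w : C, w ∉ X → (w : G) ∈ K → Q w := fun w hw hwK => by
    refine (hQ w hw z hzX (IsCyclic.mem_zpowers_iff_orderOf_dvd.2 ?_)).2 hQz
    rw [hz, ← Subgroup.orderOf_coe]
    exact orderOf_dvd_of_pow_eq_one ((hmemK _).1 hwK)
  -- No edge from `C \ K` goes up out of `C`: a cyclic group containing `K` and `w` meets `C` in
  -- order divisible by `p` and by `m`, hence contains `C`, and maximality gives equality.
  have hout : ∀ w w' : G, w ∈ C → w ∉ K → w ∈ Subgroup.zpowers w' → w' ∈ C := by
    intro w w' hwC hwK hww'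
    obtain ⟨g, hg, hKg, -⟩ := exists_zpowers_ge hp hpm he hcard hK w'
    have hpw : p ∣ orderOf w := by
      rwa [mem_iff_not_dvd_orderOf hp hpm hcard hK, not_not] at hwK
    have hwg : w ∈ Subgroup.zpowers g := Subgroup.zpowers_le.2 hg hww'
    set I := C ⊓ Subgroup.zpowers g with hI
    have h1 : p ∣ Nat.card I := hpw.trans (by
      rw [← Subgroup.orderOf_mk w (show w ∈ I from ⟨hwC, hwg⟩)]
      exact orderOf_dvd_natCard _)
    have h2 : m ∣ Nat.card I := hK ▸ Subgroup.card_dvd_of_le (le_inf hKC hKg)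
    have h3 : I = C := Subgroup.eq_of_le_of_card_ge inf_le_left
      (hCcard ▸ Nat.le_of_dvd Nat.card_pos (hpm.mul_dvd_of_dvd_of_dvd h1 h2))
    have h4 : C ≤ Subgroup.zpowers g := h3 ▸ inf_le_right
    rw [hC.eq_of_le (show IsCyclic (Subgroup.zpowers g) from inferInstance) h4]
    exact hg
  have hmem : ∀ w : C, (w : G) ∉ (Subtype.val : C → G) '' X ↔ w ∉ X := fun w => by simp
  refine (isCutSet_powerGraph_iff _).2 ⟨fun x => ∃ h : x ∈ C, ¬ Q ⟨x, h⟩,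
    ⟨v, (hmem v).2 hvX, v.2, hQv⟩, ⟨z, (hmem z).2 hzX, fun ⟨_, h⟩ => h hQz⟩, ?_⟩
  intro x hx y hy hxy
  constructor
  · rintro ⟨hxC, hQx⟩
    have hx' := (hmem ⟨x, hxC⟩).1 hx
    have hyC := hout x y hxC (fun hxK => hQx (hQK _ hx' hxK)) hxy
    exact ⟨hyC, fun h => hQx ((hQ _ hx' ⟨y, hyC⟩ ((hmem ⟨y, hyC⟩).1 hy)
      (mem_zpowers_subtype_iff.2 hxy)).2 h)⟩
  · rintro ⟨hyC, hQy⟩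
    have hxC : x ∈ C := Subgroup.zpowers_le.2 hyC hxy
    exact ⟨hxC, fun h => hQy ((hQ ⟨x, hxC⟩ ((hmem ⟨x, hxC⟩).1 hx) ⟨y, hyC⟩
      ((hmem ⟨y, hyC⟩).1 hy) (mem_zpowers_subtype_iff.2 hxy)).1 h)⟩

/-- If there were only one subgroup of order `p`, an element `g` of maximal order would generate
`P`: inductively `x ^ p = g ^ s`, the exponent of `P` forces `p ∣ s`, and `x` differs from a power
of `g` by an element of order dividing `p`. -/
theorem IsPGroup.exists_orderOf_eq_prime_notMem_zpowers {P : Type*} [CommGroup P] [Finite P]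
    {p : ℕ} (hp : p.Prime) (hP : IsPGroup p P) (hcyc : ¬ IsCyclic P) :
    ∃ a b : P, orderOf a = p ∧ orderOf b = p ∧ a ∉ Subgroup.zpowers b := by
  have := Fact.mk hp
  by_contra! hall
  refine hcyc ?_
  obtain ⟨g, hg⟩ := Monoid.exists_orderOf_eq_exponent (G := P) Monoid.ExponentExists.of_finite
  obtain ⟨e, he⟩ := (IsPGroup.iff_orderOf.1 hP) g
  have hexp : ∀ x : P, x ^ p ^ e = 1 := fun x => by
    rw [← he, hg, Monoid.pow_exponent_eq_one]
  rcases e with _ | e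
  · have : Subsingleton P := ⟨fun x y => by simpa using (hexp x).trans (hexp y).symm⟩
    infer_instance
  have hg' : orderOf (g ^ p ^ e) = p := by
    rw [orderOf_pow_of_dvd (pow_pos hp.pos e).ne' (he ▸ pow_dvd_pow p (Nat.le_succ e)), he,
      pow_succ]
    exact Nat.mul_div_cancel_left _ (pow_pos hp.pos e)
  have key : ∀ k, ∀ x : P, x ^ p ^ k = 1 → x ∈ Subgroup.zpowers g := by
    intro k
    induction k with
    | zero =>
      intro x hx
      rw [pow_zero, pow_one] at hx
      exact hx ▸ one_mem _
    | succ k ih =>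
      intro x hx
      obtain ⟨s, hs⟩ := ih (x ^ p) (by rw [← pow_mul, ← pow_succ', hx])
      have hs : g ^ s = x ^ p := hs
      have h1 : g ^ (s * (p ^ e : ℕ)) = 1 := by
        rw [zpow_mul, hs, zpow_natCast, ← pow_mul, ← pow_succ', hexp]
      have h2 := orderOf_dvd_iff_zpow_eq_one.2 h1
      rw [he, pow_succ'] at h2
      push_cast at h2
      obtain ⟨l, rfl⟩ := Int.dvd_of_mul_dvd_mul_right
        (pow_ne_zero e (Int.natCast_ne_zero.2 hp.ne_zero)) h2
      have h3 : (x * (g ^ l)⁻¹) ^ p = 1 := by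
        rw [mul_pow, ← hs, inv_pow, ← zpow_natCast (g ^ l), ← zpow_mul, mul_comm l,
          mul_inv_cancel]
      have h4 : x * (g ^ l)⁻¹ ∈ Subgroup.zpowers g := by
        rcases (Nat.dvd_prime hp).1 (orderOf_dvd_of_pow_eq_one h3) with h | h
        · rw [orderOf_eq_one_iff.1 h]
          exact one_mem _
        · exact Subgroup.zpowers_le.2 (Subgroup.npow_mem_zpowers _ _) (hall _ _ h hg')
      have h5 := Subgroup.mul_mem _ h4 (Subgroup.zpow_mem_zpowers g l)
      rwa [inv_mul_cancel_right] at h5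
  exact ⟨g, fun x => key (e + 1) x (hexp x)⟩

/-! ### Numerical estimates -/

/-- The worst case is `(2/3)(4/5) = 8/15 > 1/2`; for `q = r = 3` the product would be only `4/9`. -/
theorem le_two_mul_totient_of_odd {q r a b : ℕ} (hq : q.Prime) (hr : r.Prime) (hq3 : 3 ≤ q)
    (hr3 : 3 ≤ r) (hqr : q ≠ r) (ha : 0 < a) (hb : 0 < b) :
    q ^ a * r ^ b ≤ 2 * (q ^ a * r ^ b).totient := by
  obtain ⟨a, rfl⟩ := Nat.exists_eq_add_one.2 ha
  obtain ⟨b, rfl⟩ := Nat.exists_eq_add_one.2 hb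
  rw [Nat.totient_mul (Nat.Coprime.pow _ _ ((Nat.coprime_primes hq hr).2 hqr)),
    Nat.totient_prime_pow_succ hq, Nat.totient_prime_pow_succ hr]
  obtain ⟨x, rfl⟩ : ∃ x, q = x + 3 := ⟨q - 3, by omega⟩
  obtain ⟨y, rfl⟩ : ∃ y, r = y + 3 := ⟨r - 3, by omega⟩
  have h : (x + 3) * (y + 3) ≤ 2 * ((x + 2) * (y + 2)) := by
    have : 1 ≤ x + y := by omega
    nlinarith
  have := Nat.mul_le_mul_left ((x + 3) ^ a * (y + 3) ^ b) h
  simp only [show x + 3 - 1 = x + 2 from rfl, show y + 3 - 1 = y + 2 from rfl]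
  rw [pow_succ, pow_succ]
  linarith

theorem le_four_mul_totient_of_two {r a b : ℕ} (hr : r.Prime) (hr3 : 3 ≤ r) (ha : 0 < a)
    (hb : 0 < b) : 2 ^ a * r ^ b ≤ 4 * (2 ^ a * r ^ b).totient := by
  obtain ⟨a, rfl⟩ := Nat.exists_eq_add_one.2 ha
  obtain ⟨b, rfl⟩ := Nat.exists_eq_add_one.2 hb
  rw [Nat.totient_mul (Nat.Coprime.pow _ _ ((Nat.coprime_primes Nat.prime_two hr).2 (by omega))),
    Nat.totient_prime_pow_succ Nat.prime_two, Nat.totient_prime_pow_succ hr]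
  obtain ⟨x, rfl⟩ : ∃ x, r = x + 3 := ⟨r - 3, by omega⟩
  have := Nat.mul_le_mul_left (2 ^ a * (x + 3) ^ b) (show 2 * (x + 3) ≤ 4 * (x + 2) by omega)
  simp only [show x + 3 - 1 = x + 2 from rfl, show 2 - 1 = 1 from rfl]
  rw [pow_succ, pow_succ]
  linarith

theorem two_le_totient_prime_pow {p c : ℕ} (hp : p.Prime) (hc : 0 < c) (h : 3 ≤ p ∨ 2 ≤ c) :
    2 ≤ (p ^ c).totient := by
  obtain ⟨c, rfl⟩ := Nat.exists_eq_add_one.2 hc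
  rw [Nat.totient_prime_pow_succ hp]
  rcases h with h | h
  · exact (show 2 ≤ p - 1 by omega).trans (Nat.le_mul_of_pos_left _ (pow_pos hp.pos _))
  · obtain ⟨c, rfl⟩ := Nat.exists_eq_add_one.2 (show 0 < c by omega)
    have h1 : 2 ≤ p ^ (c + 1) := hp.two_le.trans (Nat.le_self_pow (by omega) p)
    exact h1.trans (Nat.le_mul_of_pos_right _ (by have := hp.two_le; omega))

theorem four_le_totient_prime_pow {p c : ℕ} (hp : p.Prime) (hc : 0 < c)
    (h : 5 ≤ p ∨ 3 ≤ p ∧ 2 ≤ c) : 4 ≤ (p ^ c).totient := by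
  obtain ⟨c, rfl⟩ := Nat.exists_eq_add_one.2 hc
  rw [Nat.totient_prime_pow_succ hp]
  rcases h with h | ⟨h3, h⟩
  · exact (show 4 ≤ p - 1 by omega).trans (Nat.le_mul_of_pos_left _ (pow_pos hp.pos _))
  · have h1 : 3 ≤ p ^ c := h3.trans (Nat.le_self_pow (by omega) p)
    exact le_trans (by norm_num) (Nat.mul_le_mul h1 (show 2 ≤ p - 1 by omega))

theorem five_le_of_prime_of_ne_three {r : ℕ} (hr : r.Prime) (h3 : 3 ≤ r) (hne : r ≠ 3) :
    5 ≤ r := by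
  by_contra h
  have : r = 4 := by omega
  subst this
  exact absurd hr (by decide)

theorem mul_le_totient_of_odd {p c q r a b : ℕ} (hp : p.Prime) (hc : 0 < c)
    (h : 3 ≤ p ∨ 2 ≤ c) (hq : q.Prime) (hr : r.Prime) (hq3 : 3 ≤ q) (hr3 : 3 ≤ r) (hqr : q ≠ r)
    (ha : 0 < a) (hb : 0 < b) (hpm : p.Coprime (q ^ a * r ^ b)) :
    q ^ a * r ^ b ≤ (p ^ c * (q ^ a * r ^ b)).totient := by
  rw [Nat.totient_mul (Nat.Coprime.pow_left c hpm)]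
  exact (le_two_mul_totient_of_odd hq hr hq3 hr3 hqr ha hb).trans
    (Nat.mul_le_mul_right _ (two_le_totient_prime_pow hp hc h))

theorem lt_ncard_of_card_eq_of_even {H : Type*} [CommGroup H] [Finite H] [IsCyclic H]
    {p c r a b : ℕ} (hp : p.Prime) (hp3 : 3 ≤ p) (hc : 0 < c) (hr : r.Prime) (hr3 : 3 ≤ r)
    (hpr : p ≠ r) (ha : 0 < a) (hb : 0 < b) (hcard : Nat.card H = p ^ c * (2 ^ a * r ^ b))
    {X : Set H} (hX : IsCutSet (powerGraph H) X) : 2 ^ a * r ^ b < X.ncard := by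
  have hpm : p.Coprime (2 ^ a * r ^ b) := Nat.Coprime.mul_right
    (Nat.Coprime.pow_right _ ((Nat.coprime_primes hp Nat.prime_two).2 (by omega)))
    (Nat.Coprime.pow_right _ ((Nat.coprime_primes hp hr).2 hpr))
  by_cases h : 5 ≤ p ∨ 3 ≤ p ∧ 2 ≤ c
  · have hm : 0 < 2 ^ a * r ^ b := Nat.mul_pos (pow_pos two_pos _) (pow_pos hr.pos _)
    refine lt_of_le_of_lt ?_ (IsCyclic.totient_card_lt_ncard ?_ hX)
    · rw [hcard, Nat.totient_mul (Nat.Coprime.pow_left c hpm)]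
      exact (le_four_mul_totient_of_two hr hr3 ha hb).trans
        (Nat.mul_le_mul_right _ (four_le_totient_prime_pow hp hc h))
    · rw [hcard]
      exact (Nat.one_lt_pow hc.ne' hp.one_lt).trans_le (Nat.le_mul_of_pos_right _ hm)
  · have hp' : p = 3 := by
      by_contra hne
      exact h (Or.inl (five_le_of_prime_of_ne_three hp hp3 hne))
    subst hp'
    have hc1 : c = 1 := by omega
    subst hc1
    exact lt_ncard_of_card_eq_three_mul hr (five_le_of_prime_of_ne_three hr hr3 (Ne.symm hpr))
      ha hb (by rw [hcard, pow_one]) hX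

/-! ### Minimum cut-sets of the whole group -/

theorem isMinimumCutSet_iff_and_vertexConnectivity_eq {G : Type*} [CommGroup G] [Finite G]
    {p m e : ℕ} (hp : p.Prime) (hpm : p.Coprime m) (he : 0 < e) (hcard : Nat.card G = p ^ e * m)
    {K : Subgroup G} [IsCyclic K] (hK : Nat.card K = m)
    (hKcut : IsCutSet (powerGraph G) (K : Set G))
    (hbig : ∀ D : Subgroup G, IsMaximalCyclic D → ∀ Y : Set D, IsCutSet (powerGraph D) Y →
      m < Y.ncard) :
    (∀ X : Set G, IsMinimumCutSet (powerGraph G) X ↔ X = (K : Set G)) ∧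
      vertexConnectivity (powerGraph G) = m := by
  have hKn : (K : Set G).ncard = m := hK
  have hlt : ∀ X, IsCutSet (powerGraph G) X → ¬ (K : Set G) ⊆ X → (K : Set G).ncard < X.ncard := by
    intro X hX hKX
    obtain ⟨D, hD, hDX⟩ := exists_isMaximalCyclic_isCutSet_preimage hp hpm he hcard hK hX hKX
    rw [hKn]
    exact (hbig D hD _ hDX).trans_le (ncard_preimage_val_le X)
  refine ⟨isMinimumCutSet_iff_of_forall_lt hKcut hlt, le_antisymm ?_ ?_⟩
  · exact hKn ▸ vertexConnectivity_le_of_isCutSet hKcut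
  · refine le_vertexConnectivity ?_ fun X hX => ?_
    · have hm : 0 < m := hK ▸ Nat.card_pos
      have : 1 < p ^ e := Nat.one_lt_pow he.ne' hp.one_lt
      rw [hcard]
      nlinarith
    · by_cases hKX : (K : Set G) ⊆ X
      · exact hKn ▸ Set.ncard_le_ncard hKX (Set.toFinite _)
      · exact hKn ▸ (hlt X hX hKX).le

theorem vertexConnectivity_eq_of_card_eq_two_mul {G : Type*} [CommGroup G] [Finite G]
    {q r a b e : ℕ} (hq : q.Prime) (hr : r.Prime) (hq3 : 3 ≤ q) (hqr : q < r) (ha : 0 < a)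
    (hb : 0 < b) (he : 0 < e) (hcard : Nat.card G = 2 ^ e * (q ^ a * r ^ b))
    {K : Subgroup G} [IsCyclic K] (hK : Nat.card K = q ^ a * r ^ b) {C : Subgroup G}
    (hC : IsMaximalCyclic C) (hCcard : Nat.card C = 2 * (q ^ a * r ^ b)) :
    vertexConnectivity (powerGraph G) = vertexConnectivity (powerGraph C) ∧
      vertexConnectivity (powerGraph C) ≤ q ^ a * r ^ b := by
  have hcycC : IsCyclic C := hC.prop
  have hodd : ∀ {s : ℕ}, s.Prime → 3 ≤ s → Nat.Coprime 2 s := fun hs h3 =>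
    (Nat.coprime_primes Nat.prime_two hs).2 (by omega)
  have h2m : Nat.Coprime 2 (q ^ a * r ^ b) :=
    Nat.Coprime.mul_right (Nat.Coprime.pow_right _ (hodd hq hq3))
      (Nat.Coprime.pow_right _ (hodd hr (by omega)))
  obtain ⟨Y, hY, hYm, hYφ⟩ :=
    exists_isCutSet_of_card_eq_two_mul hq hr hq3 hqr ha hb hCcard
  have hYle := vertexConnectivity_le_of_isCutSet hY
  have hm1 : 1 < q ^ a * r ^ b := (Nat.one_lt_pow ha.ne' hq.one_lt).trans_le
    (Nat.le_mul_of_pos_right _ (pow_pos hr.pos _))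
  refine ⟨le_antisymm ?_ ?_, hYle.trans hYm⟩
  · obtain ⟨X, hXn, hX | hX⟩ := exists_ncard_eq_vertexConnectivity (powerGraph C)
    · rw [← hXn, ← Set.ncard_image_of_injective X Subtype.val_injective]
      refine vertexConnectivity_le_of_isCutSet
        (hC.isCutSet_image Nat.prime_two h2m he hcard hK hCcard hX ?_)
      -- Since `φ(2m) + φ(m) = 2 φ(m)`, the lifting bound is exactly the second estimate on `Y`.
      rw [Nat.totient_mul h2m, Nat.totient_two, one_mul]
      omega
    · have h1 := Set.ncard_add_ncard_compl X
      have h2 := Nat.totient_lt _ hm1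
      omega
  · refine le_vertexConnectivity ?_ fun X hX => ?_
    · have : 2 ≤ 2 ^ e := Nat.le_self_pow he.ne' 2
      rw [hcard]
      nlinarith
    · by_cases hKX : (K : Set G) ⊆ X
      · exact (hYle.trans hYm).trans (hK ▸ Set.ncard_le_ncard hKX (Set.toFinite _))
      · obtain ⟨D, hD, hDX⟩ :=
          exists_isMaximalCyclic_isCutSet_preimage Nat.prime_two h2m he hcard hK hX hKX
        have hcycD : IsCyclic D := hD.prop
        obtain ⟨-, d, hd, hDcard⟩ := hD.le_and_exists_card_eq Nat.prime_two h2m he hcard hK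
        refine le_trans ?_ (ncard_preimage_val_le (s := (D : Set G)) X)
        -- For `d > 1` the generators of `D` alone number at least `m`; for `d = 1`, `D` is
        -- isomorphic to `C`.
        rcases Nat.lt_or_ge 1 d with hd1 | hd1
        · refine (hYle.trans hYm).trans ((mul_le_totient_of_odd Nat.prime_two hd (Or.inr hd1) hq hr
            hq3 (by omega) hqr.ne ha hb h2m).trans ?_)
          rw [← hDcard]
          exact (IsCyclic.totient_card_lt_ncard (hDcard ▸ (Nat.one_lt_pow hd.ne'
            (by norm_num)).trans_le (Nat.le_mul_of_pos_right _ (by omega))) hDX).le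
        · have hd1 : d = 1 := by omega
          subst hd1
          let f : D ≃* C := mulEquivOfCyclicCardEq (by rw [hDcard, hCcard, pow_one])
          have h1 := vertexConnectivity_le_of_isCutSet (hDX.image_mulEquiv f)
          rwa [Set.ncard_image_of_injective _ f.injective] at h1

/-! ### Sylow subgroups -/

theorem Sylow.natCard_eq_pow {G : Type*} [Group G] [Finite G] {q e m : ℕ} (hq : q.Prime)
    (hqm : q.Coprime m) (hcard : Nat.card G = q ^ e * m) (S : Sylow q G) :
    Nat.card S = q ^ e := by
  have := Fact.mk hq
  have hm : m ≠ 0 := by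
    rintro rfl
    exact Nat.card_pos.ne' (hcard.trans (mul_zero _))
  rw [S.card_eq_multiplicity, hcard, Nat.factorization_mul (pow_pos hq.pos _).ne' hm]
  simp [hq.factorization_self,
    Nat.factorization_eq_zero_of_not_dvd ((Nat.Prime.coprime_iff_not_dvd hq).1 hqm)]

theorem isCyclic_sup_and_card_of_coprime {G : Type*} [CommGroup G] [Finite G] {A B : Subgroup G}
    (hA : IsCyclic A) (hB : IsCyclic B) (hAB : (Nat.card A).Coprime (Nat.card B)) :
    IsCyclic ↥(A ⊔ B) ∧ Nat.card ↥(A ⊔ B) = Nat.card A * Nat.card B := by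
  obtain ⟨α, rfl⟩ := (Subgroup.isCyclic_iff_exists_zpowers_eq_top A).1 hA
  obtain ⟨β, rfl⟩ := (Subgroup.isCyclic_iff_exists_zpowers_eq_top B).1 hB
  rw [Nat.card_zpowers, Nat.card_zpowers] at hAB ⊢
  have h : Subgroup.zpowers α ⊔ Subgroup.zpowers β = Subgroup.zpowers (α * β) := by
    refine le_antisymm (sup_le ?_ ?_) ?_
    · exact Subgroup.zpowers_le.2 (mem_zpowers_mul_of_coprime hAB)
    · rw [mul_comm]
      exact Subgroup.zpowers_le.2 (mem_zpowers_mul_of_coprime hAB.symm)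
    · exact Subgroup.zpowers_le.2 (Subgroup.mul_mem_sup (Subgroup.mem_zpowers α)
        (Subgroup.mem_zpowers β))
  rw [h, Nat.card_zpowers, (Commute.all _ _).orderOf_mul_eq_mul_orderOf_of_coprime hAB]
  exact ⟨inferInstance, rfl⟩

theorem theorem1p4 {G : Type*} [CommGroup G] [Finite G] (hG : ¬ IsCyclic G)
    (p n : Fin 3 → ℕ) (hp : ∀ i, (p i).Prime) (hmono : StrictMono p) (hn : ∀ i, 0 < n i)
    (hcard : Nat.card G = p 0 ^ n 0 * p 1 ^ n 1 * p 2 ^ n 2)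
    (P : ∀ i : Fin 3, Sylow (p i) G)
    (hP : ∃! k : Fin 3, ¬ IsCyclic (P k : Subgroup G)) :
    (p 0 = 2 → ¬ IsCyclic (P 0 : Subgroup G) →
      ∀ C : Subgroup G, IsMinOrderMaximalCyclic C →
        vertexConnectivity (powerGraph G) =
            min ((P 1 : Set G) * (P 2 : Set G)).ncard (vertexConnectivity (powerGraph C)) ∧
        ∃ c : ℕ, 0 < c ∧ Nat.card C = 2 ^ c * p 1 ^ n 1 * p 2 ^ n 2 ∧
          (1 < c →
            vertexConnectivity (powerGraph G) = ((P 1 : Set G) * (P 2 : Set G)).ncard) ∧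
          (c = 1 →
            vertexConnectivity (powerGraph G) = vertexConnectivity (powerGraph C))) ∧
    (p 0 = 2 → ∀ j k : Fin 3, ({j, k} : Finset (Fin 3)) = {1, 2} →
      ¬ IsCyclic (P k : Subgroup G) →
        (∀ X : Set G, IsMinimumCutSet (powerGraph G) X ↔ X = (P 0 : Set G) * (P j : Set G)) ∧
        vertexConnectivity (powerGraph G) = ((P 0 : Set G) * (P j : Set G)).ncard ∧
        ((P 0 : Set G) * (P j : Set G)).ncard = p 0 ^ n 0 * p j ^ n j) ∧
    (3 ≤ p 0 → ∀ i j k : Fin 3, ({i, j, k} : Finset (Fin 3)) = {0, 1, 2} →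
      ¬ IsCyclic (P k : Subgroup G) →
        (∀ X : Set G, IsMinimumCutSet (powerGraph G) X ↔ X = (P i : Set G) * (P j : Set G)) ∧
        vertexConnectivity (powerGraph G) = ((P i : Set G) * (P j : Set G)).ncard ∧
        ((P i : Set G) * (P j : Set G)).ncard = p i ^ n i * p j ^ n j) := by
  have hlt : p 0 < p 1 ∧ p 1 < p 2 := ⟨hmono (by decide), hmono (by decide)⟩
  have hne : ∀ {i j : Fin 3}, i ≠ j → p i ≠ p j := fun h => hmono.injective.ne h
  have hmin : ∀ i, p 0 ≤ p i := fun i => hmono.monotone (Fin.zero_le i)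
  have hprod : ∀ i j k : Fin 3, i ≠ j → i ≠ k → j ≠ k →
      Nat.card G = p k ^ n k * (p i ^ n i * p j ^ n j) := by
    intro i j k hij hik hjk
    have huniv : ∀ i j k : Fin 3, i ≠ j → i ≠ k → j ≠ k → Finset.univ = {k, i, j} := by decide
    have h := Fin.prod_univ_three fun i => p i ^ n i
    rw [hcard, ← h, huniv i j k hij hik hjk, Finset.prod_insert (by simp [hik.symm, hjk.symm]),
      Finset.prod_pair hij]
  have hco : ∀ i j k : Fin 3, i ≠ k → j ≠ k → (p k).Coprime (p i ^ n i * p j ^ n j) :=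
    fun i j k hik hjk => Nat.Coprime.mul_right
      (Nat.Coprime.pow_right _ ((Nat.coprime_primes (hp k) (hp i)).2 (hne hik.symm)))
      (Nat.Coprime.pow_right _ ((Nat.coprime_primes (hp k) (hp j)).2 (hne hjk.symm)))
  have hother : ∀ i : Fin 3, ∃ j k, i ≠ j ∧ i ≠ k ∧ j ≠ k := by decide
  have hS : ∀ i, Nat.card (P i) = p i ^ n i := fun i => by
    obtain ⟨j, k, hij, hik, hjk⟩ := hother i
    exact (P i).natCard_eq_pow (hp i) (hco j k i hij.symm hik.symm)
      (hprod j k i hjk hij.symm hik.symm)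
  have setup : ∀ i j k : Fin 3, i ≠ j → i ≠ k → j ≠ k → ¬ IsCyclic (P k : Subgroup G) →
      ∃ K : Subgroup G, IsCyclic K ∧ Nat.card K = p i ^ n i * p j ^ n j ∧
        (P i : Set G) * (P j : Set G) = (K : Set G) ∧ IsCutSet (powerGraph G) (K : Set G) := by
    intro i j k hij hik hjk hk
    have hcyc : ∀ l, l ≠ k → IsCyclic (P l : Subgroup G) := fun l hl => by
      by_contra hlc
      exact hl (hP.unique hlc hk)
    obtain ⟨h1, h2⟩ := isCyclic_sup_and_card_of_coprime (hcyc i hik) (hcyc j hjk)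
      ((hS i).symm ▸ (hS j).symm ▸ Nat.Coprime.pow _ _
        ((Nat.coprime_primes (hp i) (hp j)).2 (hne hij)))
    have h3 : Nat.card ↥((P i : Subgroup G) ⊔ (P j : Subgroup G)) = p i ^ n i * p j ^ n j := by
      rw [h2, ← hS i, ← hS j]
    refine ⟨_, h1, h3, (Subgroup.mul_normal _ _).symm, ?_⟩
    obtain ⟨a, b, ha, hb, hab⟩ :=
      (P k).isPGroup'.exists_orderOf_eq_prime_notMem_zpowers (hp k) hk
    exact isCutSet_of_orderOf_eq_prime (hp k) (hco i j k hik hjk) (hprod i j k hij hik hjk) h3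
      (a := a) (b := b) (by rw [Subgroup.orderOf_coe, ha]) (by rw [Subgroup.orderOf_coe, hb])
      (fun h => hab (mem_zpowers_subtype_iff.2 h))
  refine ⟨fun h2 hk C ⟨hC, hCmin⟩ => ?_, fun h2 j k hjk hk => ?_, fun h3 i j k hijk hk => ?_⟩
  · obtain ⟨K, hKcyc, hK, hKeq, hKcut⟩ := setup 1 2 0 (by decide) (by decide) (by decide) hk
    have hKn : (K : Set G).ncard = p 1 ^ n 1 * p 2 ^ n 2 := hK
    have hG' := hprod 1 2 0 (by decide) (by decide) (by decide)
    have hcop := hco 1 2 0 (by decide) (by decide)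
    rw [h2] at hG' hcop
    have h13 : 3 ≤ p 1 := by omega
    have h23 : 3 ≤ p 2 := by omega
    have hm : 0 < p 1 ^ n 1 * p 2 ^ n 2 := hK ▸ Nat.card_pos
    obtain ⟨-, c, hc, hCcard⟩ := hC.le_and_exists_card_eq Nat.prime_two hcop (hn 0) hG' hK
    have hle : ∀ d, 1 < d →
        p 1 ^ n 1 * p 2 ^ n 2 ≤ (2 ^ d * (p 1 ^ n 1 * p 2 ^ n 2)).totient := fun d hd =>
      mul_le_totient_of_odd Nat.prime_two (by omega) (Or.inr hd) (hp 1) (hp 2) h13 h23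
        hlt.2.ne (hn 1) (hn 2) hcop
    have hone : ∀ d, 0 < d → 1 < 2 ^ d * (p 1 ^ n 1 * p 2 ^ n 2) := fun d hd =>
      (Nat.one_lt_pow hd.ne' (by norm_num)).trans_le (Nat.le_mul_of_pos_right _ hm)
    have hbigcase : 1 < c → vertexConnectivity (powerGraph G) = p 1 ^ n 1 * p 2 ^ n 2 ∧
        p 1 ^ n 1 * p 2 ^ n 2 ≤ vertexConnectivity (powerGraph C) := by
      intro hc1
      have hCcyc : IsCyclic C := hC.prop
      refine ⟨(isMinimumCutSet_iff_and_vertexConnectivity_eq Nat.prime_two hcop (hn 0) hG' hK hKcut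
        fun D hD Y hY => ?_).2, ?_⟩
      · have hDcyc : IsCyclic D := hD.prop
        obtain ⟨-, d, hd, hDcard⟩ := hD.le_and_exists_card_eq Nat.prime_two hcop (hn 0) hG' hK
        -- Minimality of `C` gives `d ≥ c > 1` for every maximal cyclic `D`, so the totient bound
        -- applies to all of them.
        have h1 := hCmin D hD
        rw [hCcard, hDcard] at h1
        have h3 := (Nat.pow_le_pow_iff_right (by norm_num)).1 (Nat.le_of_mul_le_mul_right h1 hm)
        refine (hle d (by omega)).trans_lt ?_
        rw [← hDcard]
        exact IsCyclic.totient_card_lt_ncard (hDcard ▸ hone d hd) hY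
      · refine (hle c hc1).trans ?_
        rw [← hCcard]
        exact IsCyclic.totient_card_le_vertexConnectivity (hCcard ▸ hone c hc)
    have hsmallcase : c = 1 → vertexConnectivity (powerGraph G) =
        vertexConnectivity (powerGraph C) ∧
          vertexConnectivity (powerGraph C) ≤ p 1 ^ n 1 * p 2 ^ n 2 := by
      rintro rfl
      exact vertexConnectivity_eq_of_card_eq_two_mul (hp 1) (hp 2) h13 hlt.2 (hn 1) (hn 2) (hn 0)
        hG' hK hC (by rw [hCcard, pow_one])
    rw [hKeq, hKn]
    refine ⟨?_, c, hc, by rw [hCcard, mul_assoc], fun h => (hbigcase h).1,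
      fun h => (hsmallcase h).1⟩
    rcases Nat.lt_or_ge 1 c with h | h
    · rw [min_eq_left (hbigcase h).2, (hbigcase h).1]
    · have := hsmallcase (by omega)
      rw [min_eq_right this.2, this.1]
  · have hidx : ∀ j k : Fin 3, ({j, k} : Finset (Fin 3)) = {1, 2} → 0 ≠ j ∧ 0 ≠ k ∧ j ≠ k := by
      decide
    obtain ⟨h0j, h0k, hjk⟩ := hidx j k hjk
    have h3 : ∀ i, 0 ≠ i → 3 ≤ p i := fun i hi => by
      have := hne hi
      have := hmin i
      omega
    obtain ⟨K, hKcyc, hK, hKeq, hKcut⟩ := setup 0 j k h0j h0k hjk hk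
    have hKn : (K : Set G).ncard = p 0 ^ n 0 * p j ^ n j := hK
    have hG' := hprod 0 j k h0j h0k hjk
    have hcop := hco 0 j k h0k hjk
    rw [hKeq, hKn]
    obtain ⟨hmincut, hκ⟩ := isMinimumCutSet_iff_and_vertexConnectivity_eq (hp k) hcop (hn k) hG' hK
      hKcut fun D hD Y hY => by
        have hDcyc : IsCyclic D := hD.prop
        obtain ⟨-, d, hd, hDcard⟩ := hD.le_and_exists_card_eq (hp k) hcop (hn k) hG' hK
        rw [h2] at hDcard ⊢
        exact lt_ncard_of_card_eq_of_even (hp k) (h3 k h0k) hd (hp j) (h3 j h0j) (hne hjk.symm)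
          (hn 0) (hn j) hDcard hY
    exact ⟨hmincut, hκ, rfl⟩
  · have hidx : ∀ i j k : Fin 3, ({i, j, k} : Finset (Fin 3)) = {0, 1, 2} →
        i ≠ j ∧ i ≠ k ∧ j ≠ k := by
      decide
    obtain ⟨hij, hik, hjk⟩ := hidx i j k hijk
    obtain ⟨K, hKcyc, hK, hKeq, hKcut⟩ := setup i j k hij hik hjk hk
    have hKn : (K : Set G).ncard = p i ^ n i * p j ^ n j := hK
    have hG' := hprod i j k hij hik hjk
    have hcop := hco i j k hik hjk
    rw [hKeq, hKn]
    obtain ⟨hmincut, hκ⟩ := isMinimumCutSet_iff_and_vertexConnectivity_eq (hp k) hcop (hn k) hG' hK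
      hKcut fun D hD Y hY => by
        have hDcyc : IsCyclic D := hD.prop
        obtain ⟨-, d, hd, hDcard⟩ := hD.le_and_exists_card_eq (hp k) hcop (hn k) hG' hK
        refine (mul_le_totient_of_odd (hp k) hd (Or.inl (h3.trans (hmin k))) (hp i) (hp j)
          (h3.trans (hmin i)) (h3.trans (hmin j)) (hne hij) (hn i) (hn j) hcop).trans_lt ?_
        rw [← hDcard]
        refine IsCyclic.totient_card_lt_ncard (hDcard ▸ ?_) hY
        exact (Nat.one_lt_pow hd.ne' (hp k).one_lt).trans_le
          (Nat.le_mul_of_pos_right _ (hK ▸ Nat.card_pos))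
    exact ⟨hmincut, hκ, rfl⟩
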